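/- For positive integers $n,k$ let $S(n,k)$ be the Sierpiński graph: its vertex set is $[k]^n$, $[k]=\{1,\dots,k\}$, and $(u_1,\dots,u_n)$, $(v_1,\dots,v_n)$ are adjacent if and only if there is $t\in[n]$ with $u_i=v_i$ for $i<t$, $u_t\neq v_t$, and $u_j=v_t$, $v_j=u_t$ for $j>t$. Its extreme vertices are the $k$ vertices $(a,\dots,a)$, $a\in[k]$. Let $S^{++}(1,k)=K_{k+1}$, and for $n\ge 2$ let $S^{++}(n,k)$ be obtained from the disjoint union of $k+1$ copies of $S(n-1,k)$ by connecting the extreme vertices of distinct copies as the complete graph $K_{k+1}$, i.e. any two copies are joined by exactly one edge between extreme vertices, and each extreme vertex of each copy lies on exactly one of these edges. For a group $G$ and a set $C\subseteq G$ with $1\notin C$ and $C^{-1}=C$, the Cayley graph $\mathrm{Cay}(G,C)$ has vertex set $G$, with $u$ and $v$ adjacent if and only if $vu^{-1}\in C$; a graph is called a Cayley graph if it is isomorphic to some $\mathrm{Cay}(G,C)$. A finite group $G$ is a Frobenius group with complement $H$ if $H$ is a nontrivial proper subgroup with $H\cap g^{-1}Hg=\{1\}$ for all $g\in G\setminus H$;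 its kernel is $N=G\setminus\bigcup_{g\in G}g^{-1}(H\setminus\{1\})g$, which is a normal subgroup by Frobenius' theorem. Theorem. Let $n,k\ge 1$. The graph $S^{++}(n,k)$ is a Cayley graph if and only if (i) $n=1$, or (ii) $k\le 2$, or (iii) $n=2$ and $k+1$ is a prime power. Furthermore, let $k+1=p^m$ with $p$ prime and $m\ge 1$. Then $$S^{++}(2,k)\cong\mathrm{Cay}\bigl(G,(H\setminus\{1\})\cup\{c\}\bigr)$$ for every finite Frobenius group $G$ with complement $H$ of order $p^m-1$ whose kernel is an elementary abelian minimal normal subgroup of order $p^m$ (an elementary abelian $p$-group), and every involution $c\in G\setminus H$. An example is the one-dimensional affine group $G=\mathrm{AGL}(1,q)$ over the field with $q=p^m=k+1$ elements, with $H$ the subgroup of the maps $x\mapsto ax$ ($a\ne 0$), of order $q-1$, and $c$ the map $x\mapsto -x-1$, which is an involution outside $H$. The elements of $G$ in no conjugate of $H\setminus\{1\}$ are the translations; they form an elementary abelian minimal normal subgroup of order $q$. If $q>2$, then $G$ is a Frobenius group with complement $H$, and for every $q$ one has $S^{++}(2,q-1)\cong\mathrm{Cay}(G,(H\setminus\{1\})\cup\{c\})$.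 -/

import Mathlib

/-! ### Cayley graphs -/

/-- `C` is a connection set in the group `G`: it misses `1` and is closed under inversion. -/
def IsConnectionSet {G : Type*} [Group G] (C : Set G) : Prop :=
  (1 : G) ∉ C ∧ ∀ c ∈ C, c⁻¹ ∈ C

/-- The Cayley graph `Cay(G, C)`: vertices are the elements of `G`, and `u` is joined to `v` when
`v * u⁻¹ ∈ C`. For a connection set `C` the symmetrization and the removal of loops done by
`SimpleGraph.fromRel` have no effect, see `cayleyGraph_adj`. -/
def cayleyGraph {G : Type*} [Group G] (C : Set G) : SimpleGraph G :=
  SimpleGraph.fromRel fun u v => v * u⁻¹ ∈ C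

theorem cayleyGraph_adj {G : Type*} [Group G] {C : Set G} (hC : IsConnectionSet C) (u v : G) :
    (cayleyGraph C).Adj u v ↔ v * u⁻¹ ∈ C := by
  rw [cayleyGraph, SimpleGraph.fromRel_adj]
  constructor
  · rintro ⟨-, h | h⟩
    · exact h
    · simpa using hC.2 _ h
  · intro h
    refine ⟨?_, Or.inl h⟩
    rintro rfl
    exact hC.1 (by simpa using h)

/-- A graph is a Cayley graph if it is isomorphic to `Cay(G, C)` for some group `G` and some
connection set `C` in `G`. -/
def IsCayleyGraph.{u} {V : Type u} (Γ : SimpleGraph V) : Prop :=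
  ∃ (G : Type u) (_ : Group G) (C : Set G), IsConnectionSet C ∧ Nonempty (Γ ≃g cayleyGraph C)

/-! ### Sierpiński graphs -/

/-- The Sierpiński graph `S(n, k)` on the words of length `n` over an alphabet with `k` letters:
`u` and `v` are adjacent when for some position `t` they agree before `t`, differ at `t`, and after
`t` the word `u` is constantly `v t` while `v` is constantly `u t`. -/
def sierpinski (n k : ℕ) : SimpleGraph (Fin n → Fin k) where
  Adj u v := ∃ t : Fin n, (∀ i, i < t → u i = v i) ∧ u t ≠ v t ∧
    ∀ j, t < j → u j = v t ∧ v j = u t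
  symm := ⟨fun _ _ ⟨t, h₁, h₂, h₃⟩ =>
    ⟨t, fun i hi => (h₁ i hi).symm, h₂.symm, fun j hj => (h₃ j hj).symm⟩⟩
  loopless := ⟨fun _ ⟨_, _, h, _⟩ => h rfl⟩

/-- The extreme vertex `(a, …, a)` of `S(n, k)`. -/
def extremeVertex (n k : ℕ) (a : Fin k) : Fin n → Fin k := fun _ => a

/-- The graph `S⁺⁺(n, k)`, for `n ≥ 1`: the disjoint union of `k + 1` copies of `S(n - 1, k)`
indexed by `Fin (k + 1)`, whose extreme vertices are connected as the complete graph on the set of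
copies. That is, `a ↦ i.succAbove a` matches the `k` extreme vertices of the copy `i` with
the `k` other copies, and for `i ≠ j` the extreme vertex of the copy `i` assigned to `j` is joined
to the extreme vertex of the copy `j` assigned to `i`. For `n = 1` every copy is a single vertex
and the graph is the complete graph on `k + 1` vertices, see `sierpinskiPP_one`. -/
def sierpinskiPP (n k : ℕ) : SimpleGraph (Fin (k + 1) × (Fin (n - 1) → Fin k)) where
  Adj p q := (p.1 = q.1 ∧ (sierpinski (n - 1) k).Adj p.2 q.2) ∨
    ∃ a b : Fin k, p.2 = extremeVertex (n - 1) k a ∧ q.2 = extremeVertex (n - 1) k b ∧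
      p.1.succAbove a = q.1 ∧ q.1.succAbove b = p.1
  symm := ⟨by
    rintro p q (⟨h, hadj⟩ | ⟨a, b, h₁, h₂, h₃, h₄⟩)
    · exact Or.inl ⟨h.symm, hadj.symm⟩
    · exact Or.inr ⟨b, a, h₂, h₁, h₄, h₃⟩⟩
  loopless := ⟨by
    rintro p (⟨-, h⟩ | ⟨a, _, -, -, h, -⟩)
    · exact (sierpinski (n - 1) k).loopless.irrefl _ h
    · exact Fin.succAbove_ne _ _ h⟩

theorem sierpinskiPP_one (k : ℕ) : sierpinskiPP 1 k = ⊤ := by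
  ext p q
  obtain ⟨i, x⟩ := p
  obtain ⟨j, y⟩ := q
  have hx : ∀ z w : Fin (1 - 1) → Fin k, z = w := fun z w => funext fun t => t.elim0
  simp only [SimpleGraph.top_adj, sierpinskiPP, ne_eq, Prod.mk.injEq, hx x y, and_true]
  constructor
  · rintro (⟨-, t, -⟩ | ⟨a, b, -, -, h, -⟩)
    · exact t.elim0
    · rintro rfl
      exact Fin.succAbove_ne _ _ h
  · intro h
    obtain ⟨a, ha⟩ := Fin.exists_succAbove_eq (Ne.symm h)
    obtain ⟨b, hb⟩ := Fin.exists_succAbove_eq h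
    exact Or.inr ⟨a, b, hx _ _, hx _ _, ha, hb⟩

/-! ### Frobenius groups -/

/-- The group `G` (finite, in all uses below) is a Frobenius group with complement `H`: `H` is a
nontrivial proper subgroup and `H ∩ H ^ g = {1}` for all `g ∉ H`, where
`H ^ g = {g⁻¹ h g | h ∈ H}`. -/
def IsFrobeniusComplement {G : Type*} [Group G] (H : Subgroup G) : Prop :=
  H ≠ ⊥ ∧ H ≠ ⊤ ∧ ∀ g, g ∉ H → (H : Set G) ∩ {x | ∃ h ∈ H, x = g⁻¹ * h * g} = {1}

/-- `N` is the Frobenius kernel belonging to the complement `H`, i.e. `N` consists of the elements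
that lie in no conjugate of `H \ {1}`. (By Frobenius' theorem this set always is a normal subgroup
of a finite Frobenius group.) -/
def IsFrobeniusKernel {G : Type*} [Group G] (H N : Subgroup G) : Prop :=
  (N : Set G) = Set.univ \ ⋃ g : G, {x | ∃ h ∈ H, h ≠ 1 ∧ x = g⁻¹ * h * g}

/-- The subgroup `N` is an elementary abelian `p`-group. -/
def IsElementaryAbelianSubgroup {G : Type*} [Group G] (p : ℕ) (N : Subgroup G) : Prop :=
  (∀ x ∈ N, ∀ y ∈ N, x * y = y * x) ∧ ∀ x ∈ N, x ^ p = 1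

/-- `N` is a minimal normal subgroup: minimal among the nontrivial normal subgroups. -/
def IsMinimalNormal {G : Type*} [Group G] (N : Subgroup G) : Prop :=
  Minimal (fun K : Subgroup G => K.Normal ∧ K ≠ ⊥) N

/-- The set `(H \ {1}) ∪ {c}`. -/
def complementConnectionSet {G : Type*} [Group G] (H : Subgroup G) (c : G) : Set G :=
  ((H : Set G) \ {1}) ∪ {c}

/-! ### The one-dimensional affine group `AGL(1, F) = F ≃ᵃ[F] F` -/

/-- The maps `x ↦ a x` with `a ≠ 0`: the stabilizer of `0` in `AGL(1, F)`. -/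
def aglStabilizer (F : Type*) [Field F] : Subgroup (F ≃ᵃ[F] F) where
  carrier := {f | f 0 = 0}
  one_mem' := rfl
  mul_mem' := by
    intro f g hf hg
    change f (g 0) = 0
    rw [show g 0 = 0 from hg]
    exact hf
  inv_mem' := by
    intro f hf
    change f.symm 0 = 0
    rw [AffineEquiv.symm_apply_eq]
    exact Eq.symm hf

/-- The translations `x ↦ x + b`. -/
def aglTranslations (F : Type*) [Field F] : Subgroup (F ≃ᵃ[F] F) :=
  (AffineEquiv.constVAddHom F F).range

/-- The map `x ↦ - x - 1`. -/
def aglInvolution (F : Type*) [Field F] : F ≃ᵃ[F] F :=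
  AffineEquiv.constVAdd F F (-1) * (LinearEquiv.neg F (M := F)).toAffineEquiv

theorem aglInvolution_apply (F : Type*) [Field F] (x : F) : aglInvolution F x = -x - 1 := by
  change -1 + -x = -x - 1
  ring

/-! For `3 ≤ k` and `2 ≤ n` the edges of `S⁺⁺(n, k)` are of two kinds: those of the `k`-cliques of
vertices that differ in the last letter only, and a matching formed by the other edges. Exactly the
clique edges lie in triangles (`inTriangle_iff`), so automorphisms preserve both kinds.

If `3 ≤ n`, some vertices lie on a hexagon alternating between the two kinds, but extreme vertices
do not. The graph is then not vertex-transitive, hence not Cayley.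

If `n = 2`, right multiplications permute the `k + 1` cliques. Two cliques are joined by one edge
only, so a multiplication fixing both fixes an end of that edge and is trivial. The stabilizer `H`
of a clique therefore has order `k`, index `k + 1`, and meets its conjugates by elements outside `H`
trivially (it is malnormal). A count of the elements outside all conjugates of `H` makes `k + 1` a
prime power (`isPrimePow_of_malnormal`).

Conversely, for malnormal `H` with these orders and an involution `c ∉ H`, the cosets `Hg` are the
cliques and left multiplication by `c` is the matching
(`nonempty_iso_cayleyGraph_complementConnectionSet`); `AGL(1, k + 1)` supplies such a pair. The
remaining graphs are complete (`n = 1` or `k = 1`) or cycles (`k = 2`). -/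

/-! ### Malnormal subgroups of finite groups -/

section Malnormal

variable {G : Type*} [Group G]

/-- Conjugates of `H` belonging to different cosets share only `1`, so each coset contributes
`Nat.card H - 1` new elements. -/
theorem ncard_conjugates_of_malnormal [Finite G] {H : Subgroup G}
    (hm : ∀ g ∉ H, ∀ h ∈ H, g⁻¹ * h * g ∈ H → h = 1) :
    {x : G | ∃ g, ∃ h ∈ H, h ≠ 1 ∧ x = g⁻¹ * h * g}.ncard = H.index * (Nat.card H - 1) := by
  let f : (G ⧸ H) × {h : H // h ≠ 1} → {x : G | ∃ g, ∃ h ∈ H, h ≠ 1 ∧ x = g⁻¹ * h * g} :=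
    fun z => ⟨z.1.out * z.2.1 * z.1.out⁻¹, z.1.out⁻¹, z.2.1, z.2.1.2,
      fun h => z.2.2 (Subtype.ext h), by simp⟩
  have hf : Function.Bijective f := by
    constructor
    · rintro ⟨q, ⟨⟨h, hh⟩, h1⟩⟩ ⟨r, ⟨⟨l, hl⟩, l1⟩⟩ e
      have e' : q.out * h * q.out⁻¹ = r.out * l * r.out⁻¹ := congrArg Subtype.val e
      have hqr : q = r := by
        rw [← q.out_eq', ← r.out_eq', QuotientGroup.eq]
        by_contra hn
        refine h1 (Subtype.ext (hm _ hn h hh ?_))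
        have : (q.out⁻¹ * r.out)⁻¹ * h * (q.out⁻¹ * r.out) = l := by
          have : h = q.out⁻¹ * (r.out * l * r.out⁻¹) * q.out := by rw [← e']; group
          rw [this]; group
        rwa [this]
      subst hqr
      simpa using e'
    · rintro ⟨x, g, h, hh, h1, rfl⟩
      obtain ⟨t, ht⟩ := QuotientGroup.mk_out_eq_mul H g⁻¹
      refine ⟨((g⁻¹ : G), ⟨⟨t⁻¹ * h * t, H.mul_mem (H.mul_mem (H.inv_mem t.2) hh) t.2⟩, ?_⟩), ?_⟩
      · intro e
        have e' : (t : G)⁻¹ * h * t = 1 := congrArg Subtype.val e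
        apply h1
        have : h = t * ((t : G)⁻¹ * h * t) * (t : G)⁻¹ := by group
        rw [this, e']; simp
      · apply Subtype.ext
        simp only [f, ht, mul_inv_rev, inv_inv]
        simp only [mul_assoc, InvMemClass.coe_inv, mul_inv_cancel_left]
  rw [← Nat.card_coe_set_eq, ← Nat.card_congr (Equiv.ofBijective f hf), Nat.card_prod]
  congr 1
  have := Set.ncard_compl ({1} : Set H)
  rw [Set.ncard_singleton] at this
  rw [← this, ← Nat.card_coe_set_eq]
  rfl

/-- A finite group with a malnormal subgroup of order `k` and index `k + 1` acts sharply
2-transitively on the cosets, so that `k + 1` is a prime power. -/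
theorem isPrimePow_of_malnormal [Finite G] {H : Subgroup G} {k : ℕ} (hk : 1 ≤ k)
    (hH : Nat.card H = k) (hG : Nat.card G = k * (k + 1))
    (hm : ∀ g ∉ H, ∀ h ∈ H, g⁻¹ * h * g ∈ H → h = 1) : IsPrimePow (k + 1) := by
  have hindex : H.index = k + 1 := by
    have := H.card_mul_index
    rw [hH, hG] at this
    exact Nat.eq_of_mul_eq_mul_left hk this
  -- Any prime divisor of `k + 1` would do: it is coprime to `k`, so an element of order `p` lies in
  -- no conjugate of `H`.
  set p := (k + 1).minFac with hp_def
  have hp : p.Prime := Nat.minFac_prime (by omega)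
  have : Fact p.Prime := ⟨hp⟩
  have hpk : p ∣ k + 1 := Nat.minFac_dvd _
  obtain ⟨x, hx⟩ := exists_prime_orderOf_dvd_card' p (hG ▸ hpk.mul_left k : p ∣ Nat.card G)
  set S := {x : G | ∃ g, ∃ h ∈ H, h ≠ 1 ∧ x = g⁻¹ * h * g} with hS
  have hScard : S.ncard = (k + 1) * (k - 1) := by
    rw [hS, ncard_conjugates_of_malnormal hm, hindex, hH]
  have hx1 : x ≠ 1 := by
    rintro rfl
    rw [orderOf_one] at hx
    exact hp.one_lt.ne hx
  have hxS : x ∉ S := by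
    rintro ⟨g, h, hh, -, rfl⟩
    have h1 : orderOf (g⁻¹ * h * g) = orderOf h := by
      have := (MulAut.conj g⁻¹).orderOf_eq h
      simpa using this
    have h2 : p ∣ k := by
      rw [← hx, h1, ← hH]
      exact H.orderOf_dvd_natCard hh
    exact hp.one_lt.ne' (Nat.dvd_one.1 ((Nat.dvd_add_right h2).1 hpk))
  -- If `z` lay in a conjugate of `H`, malnormality would force everything commuting with `z ≠ 1`,
  -- in particular `x`, into the same conjugate.
  have hZS : ∀ z ∈ Subgroup.centralizer {x}, z ∉ S := by
    rintro z hz ⟨g, h, hh, h1, rfl⟩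
    rw [Subgroup.mem_centralizer_singleton_iff] at hz
    have hg : g * x * g⁻¹ ∈ H := by
      by_contra hn
      refine h1 (hm _ hn h hh ?_)
      have : (g * x * g⁻¹)⁻¹ * h * (g * x * g⁻¹) = g * x⁻¹ * (g⁻¹ * h * g * x) * g⁻¹ := by group
      rw [this, hz]
      have : g * x⁻¹ * (x * (g⁻¹ * h * g)) * g⁻¹ = h := by group
      rwa [this]
    refine hxS ⟨g, _, hg, ?_, by group⟩
    intro e
    exact hx1 (by simpa using e)
  have hZcard : Nat.card (Subgroup.centralizer {x}) ≤ k + 1 := by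
    rw [← hindex, Subgroup.index]
    refine Nat.card_le_card_of_injective
      (fun z : Subgroup.centralizer {x} => ((z : G) : G ⧸ H)) ?_
    intro y z hyz
    have hyz' : (y : G)⁻¹ * z ∈ H := QuotientGroup.eq.1 hyz
    by_contra hne
    refine hZS _ (y⁻¹ * z).2 ⟨1, _, hyz', ?_, by simp⟩
    intro e
    exact hne (Subtype.ext (inv_mul_eq_one.1 e))
  have hclass : {y | IsConj x y}.ncard * Nat.card (Subgroup.centralizer {x}) = k * (k + 1) := by
    have : {y | IsConj x y} = MulAction.orbit (ConjAct G) x := by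
      ext y
      rw [ConjAct.mem_orbit_conjAct, isConj_comm]
      rfl
    rw [← hG, Subgroup.nat_card_centralizer_nat_card_stabilizer, this,
      ← MulAction.index_stabilizer, mul_comm]
    exact Subgroup.card_mul_index _
  have hconj : ∀ y, IsConj x y → y ≠ 1 ∧ y ∉ S ∧ y ^ p = 1 := by
    intro y hy
    obtain ⟨g, rfl⟩ := isConj_iff.1 hy
    refine ⟨fun e => hx1 (by simpa using e), ?_, ?_⟩
    · rintro ⟨l, h, hh, h1, e⟩
      refine hxS ⟨l * g, h, hh, h1, ?_⟩
      have : x = g⁻¹ * (g * x * g⁻¹) * g := by group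
      rw [this, e]
      group
    · rw [conj_pow, ← hx, pow_orderOf_eq_one]
      simp
  have hS1 : (1 : G) ∉ S := by
    rintro ⟨g, h, -, h1, e⟩
    refine h1 ?_
    have : h = g * (g⁻¹ * h * g) * g⁻¹ := by group
    rw [this, ← e]
    simp
  have hd : Disjoint S {y | IsConj x y} :=
    Set.disjoint_left.2 fun y hy hy' => (hconj y hy').2.1 hy
  have hd1 : (1 : G) ∉ S ∪ {y | IsConj x y} := by
    rintro (h | h)
    · exact hS1 h
    · exact (hconj 1 h).1 rfl
  have hcard : (insert 1 (S ∪ {y | IsConj x y})).ncard =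
      (k + 1) * (k - 1) + {y | IsConj x y}.ncard + 1 := by
    rw [Set.ncard_insert_of_notMem hd1, Set.ncard_union_eq hd, hScard]
  have hle : (insert 1 (S ∪ {y | IsConj x y})).ncard ≤ k * (k + 1) := by
    rw [← hG]
    exact Set.ncard_le_card _
  obtain ⟨j, rfl⟩ : ∃ j, k = j + 1 := ⟨k - 1, by omega⟩
  simp only [Nat.add_sub_cancel] at hcard
  -- Outside `S` there are `k` nontrivial elements, which bounds the class from above; the bound `k
  -- + 1` on the centralizer bounds it from below. So the class of `x` is everything outside `S`
  -- except `1`, and all its elements have order `p`.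
  have hclass_card : {y | IsConj x y}.ncard = j + 1 := by
    apply le_antisymm
    · nlinarith
    · by_contra hlt
      nlinarith
  have hZ : Nat.card (Subgroup.centralizer {x}) = j + 1 + 1 := by
    rw [hclass_card] at hclass
    exact Nat.eq_of_mul_eq_mul_left (by omega) hclass
  have huniv : insert 1 (S ∪ {y | IsConj x y}) = Set.univ := by
    refine Set.eq_of_subset_of_ncard_le (Set.subset_univ _) ?_
    rw [Set.ncard_univ, hcard, hG, hclass_card]
    nlinarith
  have hpgroup : IsPGroup p (Subgroup.centralizer {x}) := by
    intro z
    refine ⟨1, Subtype.ext ?_⟩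
    have : (z : G) ∈ insert 1 (S ∪ {y | IsConj x y}) := huniv ▸ Set.mem_univ _
    rcases this with h | h | h
    · simp [h]
    · exact absurd h (hZS _ z.2)
    · simpa using (hconj _ h).2.2
  obtain ⟨e, he⟩ := IsPGroup.iff_card.1 hpgroup
  rw [hZ] at he
  rw [he]
  refine hp.isPrimePow.pow ?_
  rintro rfl
  simp at he

end Malnormal

/-! ### The Cayley graph of `(H \ {1}) ∪ {c}` -/

section Construction

variable {G : Type*} [Group G]

/-- Words have length one here, so every copy is complete and all its vertices are extreme. -/
theorem sierpinskiPP_two_adj {k : ℕ} (p q : Fin (k + 1) × (Fin (2 - 1) → Fin k)) :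
    (sierpinskiPP 2 k).Adj p q ↔ (p.1 = q.1 ∧ p ≠ q) ∨
      (p.1.succAbove (p.2 0) = q.1 ∧ q.1.succAbove (q.2 0) = p.1) := by
  obtain ⟨i, x⟩ := p
  obtain ⟨j, y⟩ := q
  have hw : ∀ z : Fin (2 - 1) → Fin k, ∀ a, z = extremeVertex (2 - 1) k a ↔ z 0 = a := fun z a =>
    ⟨fun h => h ▸ rfl, fun h => funext fun t => (Subsingleton.elim (α := Fin 1) t 0) ▸ h⟩
  have hs : (sierpinski (2 - 1) k).Adj x y ↔ x ≠ y := by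
    constructor
    · rintro ⟨t, -, h, -⟩ rfl
      exact h rfl
    · intro h
      refine ⟨0, fun i hi => absurd hi (Fin.not_lt_zero (n := 1) i), fun e => h ?_, fun i hi => ?_⟩
      · exact funext fun t => (Subsingleton.elim (α := Fin 1) t 0) ▸ e
      · exact absurd hi (Subsingleton.elim (α := Fin 1) i 0 ▸ lt_irrefl _)
  simp only [sierpinskiPP, hs, hw, ne_eq, Prod.mk.injEq]
  constructor
  · rintro (⟨h, h'⟩ | ⟨a, b, rfl, rfl, h⟩)
    · exact Or.inl ⟨h, fun e => h' e.2⟩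
    · exact Or.inr h
  · rintro (⟨h, h'⟩ | h)
    · exact Or.inl ⟨h, fun e => h' ⟨h, e⟩⟩
    · exact Or.inr ⟨_, _, rfl, rfl, h⟩

theorem isConnectionSet_complementConnectionSet {H : Subgroup G} {c : G} (hc : c * c = 1)
    (hcH : c ∉ H) : IsConnectionSet (complementConnectionSet H c) := by
  refine ⟨?_, ?_⟩
  · rintro (h | h)
    · exact h.2 rfl
    · exact hcH (h ▸ H.one_mem)
  · rintro g (h | h)
    · exact Or.inl ⟨H.inv_mem h.1, fun e => h.2 (inv_eq_one.1 e)⟩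
    · rw [Set.mem_singleton_iff.1 h, inv_eq_of_mul_eq_one_left hc]
      exact Or.inr rfl

/-- A vertex `u` is encoded by its coset `Hu` and the coset of its neighbour `c * u`. Malnormality
at `c` makes the code injective, and counting makes it bijective. Asking only for orders and
malnormality admits trivial `H`, which is the case `q = 2` of the affine group. -/
theorem nonempty_iso_cayleyGraph_complementConnectionSet [Finite G] {H : Subgroup G} {c : G}
    {k : ℕ} (hk : 1 ≤ k) (hH : Nat.card H = k) (hG : Nat.card G = k * (k + 1)) (hc : c * c = 1)
    (hcH : c ∉ H) (hm : ∀ h ∈ H, c⁻¹ * h * c ∈ H → h = 1) :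
    Nonempty (sierpinskiPP 2 k ≃g cayleyGraph (complementConnectionSet H c)) := by
  have hindex : Nat.card (G ⧸ H) = k + 1 := by
    have := H.card_mul_index
    rw [hH, hG] at this
    exact Nat.eq_of_mul_eq_mul_left hk this
  let e : G ⧸ H ≃ Fin (k + 1) := Finite.equivFinOfCardEq hindex
  -- `G ⧸ H` consists of left cosets; inversion turns them into the right cosets `Hg`, which are the
  -- cliques of the Cayley graph.
  let P : G → Fin (k + 1) := fun g => e ((g⁻¹ : G) : G ⧸ H)
  have hP : ∀ u v, P u = P v ↔ v * u⁻¹ ∈ H := by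
    intro u v
    rw [← H.inv_mem_iff, mul_inv_rev, inv_inv]
    simp [P, QuotientGroup.eq]
  have hPc : ∀ u, P (c * u) ≠ P u := by
    intro u h
    rw [eq_comm, hP] at h
    exact hcH (by simpa using h)
  have hex : ∀ u, ∃ a, (P u).succAbove a = P (c * u) := fun u =>
    Fin.exists_succAbove_eq (hPc u)
  choose A hA using hex
  let f : G → Fin (k + 1) × (Fin (2 - 1) → Fin k) := fun u => (P u, fun _ => A u)
  have hf : Function.Injective f := by
    intro u v h
    have h1 : P u = P v := congrArg Prod.fst h
    have h2 : A u = A v := congrFun (congrArg Prod.snd h) (0 : Fin 1)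
    have h3 : P (c * u) = P (c * v) := by rw [← hA, ← hA, h1, h2]
    rw [hP] at h1 h3
    have h4 : v * u⁻¹ = 1 := by
      refine hm _ h1 ?_
      rw [inv_eq_of_mul_eq_one_left hc]
      rw [mul_inv_rev, inv_eq_of_mul_eq_one_left hc] at h3
      simpa [mul_assoc] using h3
    exact (mul_inv_eq_one.1 h4).symm
  have hbij : Function.Bijective f := by
    refine (Nat.bijective_iff_injective_and_card f).2 ⟨hf, ?_⟩
    rw [hG]
    simp [mul_comm]
  refine ⟨(RelIso.mk (Equiv.ofBijective f hbij) ?_ : cayleyGraph _ ≃g _).symm⟩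
  intro u v
  rw [cayleyGraph_adj (isConnectionSet_complementConnectionSet hc hcH), Equiv.ofBijective_apply,
    Equiv.ofBijective_apply, sierpinskiPP_two_adj, hf.ne_iff]
  change (P u = P v ∧ u ≠ v) ∨ ((P u).succAbove (A u) = P v ∧ (P v).succAbove (A v) = P u) ↔ _
  rw [hA, hA, hP]
  refine or_congr (and_congr Iff.rfl (not_congr ?_)) ?_
  · rw [Set.mem_singleton_iff, mul_inv_eq_one, eq_comm]
  · rw [Set.mem_singleton_iff, mul_inv_eq_iff_eq_mul]
    constructor
    · rintro ⟨h1, h2⟩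
      apply hf
      have h3 : P v = P (c * u) := h1.symm
      refine Prod.ext h3 (funext fun _ => ?_)
      apply (P v).succAbove_right_injective
      change (P v).succAbove (A v) = (P v).succAbove (A (c * u))
      rw [hA, h2, h3, hA, ← mul_assoc, hc, one_mul]
    · rintro rfl
      rw [← mul_assoc, hc, one_mul]
      exact ⟨rfl, rfl⟩

theorem IsFrobeniusComplement.malnormal {H : Subgroup G} (h : IsFrobeniusComplement H) :
    ∀ g ∉ H, ∀ x ∈ H, g⁻¹ * x * g ∈ H → x = 1 := by
  intro g hg x hx hx'
  have h1 : g⁻¹ * x * g ∈ ({1} : Set G) := h.2.2 g hg ▸ ⟨hx', x, hx, rfl⟩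
  have h2 : x = g * (g⁻¹ * x * g) * g⁻¹ := by group
  rw [h2, Set.mem_singleton_iff.1 h1]
  simp

/-- Removing the `H.index * (Nat.card H - 1)` conjugates of nontrivial elements of `H` leaves
`H.index` elements. -/
theorem card_of_isFrobeniusKernel [Finite G] {H N : Subgroup G} (h : IsFrobeniusComplement H)
    (hN : IsFrobeniusKernel H N) : Nat.card G = Nat.card H * Nat.card N := by
  have h1 : (N : Set G) = {x : G | ∃ g, ∃ h ∈ H, h ≠ 1 ∧ x = g⁻¹ * h * g}ᶜ := by
    rw [hN, Set.compl_eq_univ_sdiff]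
    congr 1
    ext x
    simp
  have h2 := Set.ncard_add_ncard_compl {x : G | ∃ g, ∃ h ∈ H, h ≠ 1 ∧ x = g⁻¹ * h * g}
  rw [← h1, ncard_conjugates_of_malnormal h.malnormal, ← Nat.card_coe_set_eq] at h2
  have h3 := H.card_mul_index
  obtain ⟨j, hj⟩ : ∃ j, Nat.card H = j + 1 := ⟨Nat.card H - 1, by have := Nat.card_pos (α := H); omega⟩
  rw [hj] at h2 h3 ⊢
  simp only [Nat.add_sub_cancel, SetLike.coe_sort_coe] at h2
  have : Nat.card N = H.index := by nlinarith
  rw [this, h3]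

end Construction

/-! ### Vertex-transitivity of Cayley graphs and invariants of edges -/

section CayleyAut

variable {G : Type*} [Group G]

/-- Right multiplication as an automorphism of a Cayley graph. -/
def cayleyGraphMulRight (C : Set G) (g : G) : cayleyGraph C ≃g cayleyGraph C where
  toEquiv := Equiv.mulRight g
  map_rel_iff' := by
    intro u v
    simp [cayleyGraph, SimpleGraph.fromRel_adj, mul_assoc]

/-- If `φ` identifies `Γ` with a Cayley graph, the automorphism of `Γ` induced by the right
multiplication with `g`. -/
def cayleyTranslation {V : Type*} {Γ : SimpleGraph V} {C : Set G} (φ : Γ ≃g cayleyGraph C) (g : G) :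
    Γ ≃g Γ :=
  (φ.trans (cayleyGraphMulRight C g)).trans φ.symm

theorem cayleyTranslation_apply {V : Type*} {Γ : SimpleGraph V} {C : Set G}
    (φ : Γ ≃g cayleyGraph C) (g u : G) :
    cayleyTranslation φ g (φ.symm u) = φ.symm (u * g) := by
  change φ.symm (φ (φ.symm u) * g) = _
  rw [RelIso.apply_symm_apply]

theorem IsCayleyGraph.exists_iso_apply_eq.{u} {V : Type u} {Γ : SimpleGraph V}
    (h : IsCayleyGraph Γ) (u v : V) : ∃ ψ : Γ ≃g Γ, ψ u = v := by
  obtain ⟨G, _, C, -, ⟨φ⟩⟩ := h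
  refine ⟨cayleyTranslation φ ((φ u)⁻¹ * φ v), ?_⟩
  have := cayleyTranslation_apply φ ((φ u)⁻¹ * φ v) (φ u)
  rwa [RelIso.symm_apply_apply, mul_inv_cancel_left, RelIso.symm_apply_apply] at this

end CayleyAut

section Triangles

variable {V : Type*}

/-- The edge `u v` lies in a triangle. -/
def InTriangle (Γ : SimpleGraph V) (u v : V) : Prop :=
  Γ.Adj u v ∧ ∃ w, Γ.Adj u w ∧ Γ.Adj w v

/-- The edge `u v` lies in no triangle. -/
def IsLonelyEdge (Γ : SimpleGraph V) (u v : V) : Prop :=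
  Γ.Adj u v ∧ ¬ InTriangle Γ u v

/-- There is a closed walk of length six through `v` whose edges alternately lie in no triangle and
in a triangle. -/
def HasAlternatingHexagon (Γ : SimpleGraph V) (v : V) : Prop :=
  ∃ v' x x' y y', IsLonelyEdge Γ v v' ∧ InTriangle Γ v' x ∧ IsLonelyEdge Γ x x' ∧
    InTriangle Γ x' y ∧ IsLonelyEdge Γ y y' ∧ InTriangle Γ y' v

variable {Γ : SimpleGraph V} (ψ : Γ ≃g Γ)


theorem InTriangle.map {u v : V} (h : InTriangle Γ u v) : InTriangle Γ (ψ u) (ψ v) := by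
  obtain ⟨h, w, h1, h2⟩ := h
  exact ⟨ψ.map_rel_iff.2 h, ψ w, ψ.map_rel_iff.2 h1, ψ.map_rel_iff.2 h2⟩

theorem IsLonelyEdge.map {u v : V} (h : IsLonelyEdge Γ u v) : IsLonelyEdge Γ (ψ u) (ψ v) := by
  refine ⟨ψ.map_rel_iff.2 h.1, fun h' => h.2 ?_⟩
  simpa using h'.map ψ.symm

theorem HasAlternatingHexagon.map {v : V} (h : HasAlternatingHexagon Γ v) :
    HasAlternatingHexagon Γ (ψ v) := by
  obtain ⟨v', x, x', y, y', h1, h2, h3, h4, h5, h6⟩ := h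
  exact ⟨_, _, _, _, _, h1.map ψ, h2.map ψ, h3.map ψ, h4.map ψ, h5.map ψ, h6.map ψ⟩

end Triangles

/-! ### Cliques of `S⁺⁺(m + 2, k)` and the edges between them -/

section Cliques

variable {m k : ℕ}

/-- The two vertices of `S⁺⁺(m + 2, k)` differ at most in the last letter. -/
def SameClique (p q : Fin (k + 1) × (Fin (m + 1) → Fin k)) : Prop :=
  p.1 = q.1 ∧ ∀ i, i < Fin.last m → p.2 i = q.2 i

/-- The two vertices of `S⁺⁺(m + 2, k)` are joined by an edge that leaves the clique of vertices
differing in the last letter only. -/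
def IsPartner (p q : Fin (k + 1) × (Fin (m + 1) → Fin k)) : Prop :=
  (p.1 = q.1 ∧ ∃ t, t < Fin.last m ∧ (∀ i, i < t → p.2 i = q.2 i) ∧ p.2 t ≠ q.2 t ∧
    ∀ j, t < j → p.2 j = q.2 t ∧ q.2 j = p.2 t) ∨
  ∃ a b, p.2 = (fun _ => a) ∧ q.2 = (fun _ => b) ∧ p.1.succAbove a = q.1 ∧ q.1.succAbove b = p.1

variable {p q r : Fin (k + 1) × (Fin (m + 1) → Fin k)}

theorem SameClique.symm (h : SameClique p q) : SameClique q p :=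
  ⟨h.1.symm, fun i hi => (h.2 i hi).symm⟩

theorem SameClique.trans (h : SameClique p q) (h' : SameClique q r) : SameClique p r :=
  ⟨h.1.trans h'.1, fun i hi => (h.2 i hi).trans (h'.2 i hi)⟩

theorem IsPartner.symm (h : IsPartner p q) : IsPartner q p := by
  rcases h with ⟨h, t, h1, h2, h3, h4⟩ | ⟨a, b, h1, h2, h3, h4⟩
  · exact Or.inl ⟨h.symm, t, h1, fun i hi => (h2 i hi).symm, h3.symm, fun j hj => (h4 j hj).symm⟩
  · exact Or.inr ⟨b, a, h2, h1, h4, h3⟩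

theorem sierpinskiPP_adj_iff :
    (sierpinskiPP (m + 2) k).Adj p q ↔ (SameClique p q ∧ p ≠ q) ∨ IsPartner p q := by
  constructor
  · rintro (⟨h, t, h1, h2, h3⟩ | h)
    · rcases (Fin.le_last t).lt_or_eq with ht | ht
      · exact Or.inr (Or.inl ⟨h, t, ht, h1, h2, h3⟩)
      · subst ht
        exact Or.inl ⟨⟨h, h1⟩, fun e => h2 (e ▸ rfl)⟩
    · exact Or.inr (Or.inr h)
  · rintro (⟨h, h'⟩ | ⟨h, t, -, h1⟩ | h)
    · refine Or.inl ⟨h.1, Fin.last m, h.2, fun e => h' ?_, fun j hj => ?_⟩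
      · refine Prod.ext h.1 (funext fun i => ?_)
        rcases (Fin.le_last i).lt_or_eq with hi | rfl
        · exact h.2 i hi
        · exact e
      · exact absurd hj (Fin.le_last j).not_gt
    · exact Or.inl ⟨h, t, h1⟩
    · exact Or.inr h

theorem IsPartner.not_sameClique (h : IsPartner p q) : ¬ SameClique p q := by
  intro h'
  rcases h with ⟨-, t, h1, -, h3, -⟩ | ⟨a, b, -, -, h3, -⟩
  · exact h3 (h'.2 t h1)
  · exact Fin.succAbove_ne _ _ (h3.trans h'.1.symm)

/-- In a nonconstant word the position `t` is the last one whose letter differs from the final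
letter, and exchanging these two letters from `t` on gives the partner. A constant word has its
partner in another copy, determined by its letter. -/
theorem IsPartner.unique (h : IsPartner p q) (h' : IsPartner p r) : q = r := by
  rcases h with ⟨h, t, h1, h2, h3, h4⟩ | ⟨a, b, h1, h2, h3, h4⟩
  · rcases h' with ⟨h', s, h1', h2', h3', h4'⟩ | ⟨a, b, h1', h2', h3', h4'⟩
    · have hts : t = s := by
        rcases lt_trichotomy t s with hts | hts | hts
        · exact absurd (((h4 s hts).1.trans (h4 _ h1).1.symm).trans (h4' _ h1').1) h3'
        · exact hts
        · exact absurd (((h4' t hts).1.trans (h4' _ h1').1.symm).trans (h4 _ h1).1) h3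
      subst hts
      refine Prod.ext (h.symm.trans h') (funext fun i => ?_)
      rcases lt_trichotomy i t with hi | rfl | hi
      · rw [← h2 i hi, h2' i hi]
      · rw [← (h4 _ h1).1, (h4' _ h1).1]
      · rw [(h4 i hi).2, (h4' i hi).2]
    · refine absurd ?_ h3
      rw [← (h4 _ h1).1, h1']
  · rcases h' with ⟨h', s, h1', h2', h3', h4'⟩ | ⟨a', b', h1', h2', h3', h4'⟩
    · refine absurd ?_ h3'
      rw [← (h4' _ h1').1, h1]
    · have ha : a = a' := congrFun (h1.symm.trans h1') 0
      have h5 : q.1 = r.1 := by rw [← h3, ← h3', ha]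
      refine Prod.ext h5 ?_
      rw [h2, h2']
      funext _
      apply q.1.succAbove_right_injective
      rw [h4, h5, h4']

theorem inTriangle_iff (hk : 3 ≤ k) :
    InTriangle (sierpinskiPP (m + 2) k) p q ↔ SameClique p q ∧ p ≠ q := by
  constructor
  · rintro ⟨h, w, h1, h2⟩
    rcases sierpinskiPP_adj_iff.1 h with h | h
    · exact h
    exfalso
    rcases sierpinskiPP_adj_iff.1 h1 with h1 | h1
    · rcases sierpinskiPP_adj_iff.1 h2 with h2 | h2
      · exact h.not_sameClique (h1.1.trans h2.1)
      · exact h1.2 (h.symm.unique h2.symm)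
    · obtain rfl := h.unique h1
      exact h2.ne rfl
  · rintro ⟨h, hne⟩
    refine ⟨sierpinskiPP_adj_iff.2 (Or.inl ⟨h, hne⟩), ?_⟩
    -- The third vertex of the triangle takes a last letter different from both; this needs `3 ≤ k`.
    obtain ⟨c, hc⟩ : ∃ c : Fin k, c ∉ ({p.2 (Fin.last m), q.2 (Fin.last m)} : Finset (Fin k)) := by
      by_contra! hall
      have := Finset.card_le_card (Finset.subset_iff.2 fun x (_ : x ∈ Finset.univ) => hall x)
      have h2 := Finset.card_le_two (a := p.2 (Fin.last m)) (b := q.2 (Fin.last m))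
      simp only [Finset.card_univ, Fintype.card_fin] at this
      omega
    simp only [Finset.mem_insert, Finset.mem_singleton, not_or] at hc
    have hw : ∀ x : Fin (k + 1) × (Fin (m + 1) → Fin k),
        SameClique x (x.1, Function.update x.2 (Fin.last m) c) := fun x =>
      ⟨rfl, fun i hi => (Function.update_of_ne hi.ne _ _).symm⟩
    have hpr := hw p
    set r : Fin (k + 1) × (Fin (m + 1) → Fin k) := (p.1, Function.update p.2 (Fin.last m) c)
      with hr
    have hrc : r.2 (Fin.last m) = c := Function.update_self _ _ _
    refine ⟨r, sierpinskiPP_adj_iff.2 (Or.inl ⟨hpr, fun e => hc.1 ?_⟩),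
      sierpinskiPP_adj_iff.2 (Or.inl ⟨hpr.symm.trans h, fun e => hc.2 ?_⟩)⟩
    · rw [← hrc, e]
    · rw [← hrc, e]

theorem isLonelyEdge_iff (hk : 3 ≤ k) :
    IsLonelyEdge (sierpinskiPP (m + 2) k) p q ↔ IsPartner p q := by
  rw [IsLonelyEdge, inTriangle_iff hk, sierpinskiPP_adj_iff]
  constructor
  · rintro ⟨h | h, h'⟩
    · exact absurd h h'
    · exact h
  · exact fun h => ⟨Or.inr h, fun h' => h.not_sameClique h'.1⟩

theorem sameClique_map (hk : 3 ≤ k) (ψ : sierpinskiPP (m + 2) k ≃g sierpinskiPP (m + 2) k)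
    (h : SameClique p q) : SameClique (ψ p) (ψ q) := by
  by_cases hpq : p = q
  · exact hpq ▸ ⟨rfl, fun _ _ => rfl⟩
  · exact ((inTriangle_iff hk).1 (((inTriangle_iff hk).2 ⟨h, hpq⟩).map ψ)).1

theorem isPartner_map (hk : 3 ≤ k) (ψ : sierpinskiPP (m + 2) k ≃g sierpinskiPP (m + 2) k)
    (h : IsPartner p q) : IsPartner (ψ p) (ψ q) :=
  (isLonelyEdge_iff hk).1 (((isLonelyEdge_iff hk).2 h).map ψ)

end Cliques

/-! ### `S⁺⁺(n, k)` is not vertex-transitive for `n, k ≥ 3` -/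

section NotTransitive

variable {m k : ℕ}

/-- The vertex `0⋯0ab` in the copy `0`. -/
def innerVertex (a b z : Fin k) : Fin (k + 1) × (Fin (m + 2) → Fin k) :=
  (0, fun i => if i = Fin.last (m + 1) then b else if i = (Fin.last m).castSucc then a else z)

theorem isPartner_innerVertex {a b : Fin k} (hab : a ≠ b) (z : Fin k) :
    IsPartner (m := m + 1) (innerVertex a b z) (innerVertex b a z) := by
  have hl : (Fin.last m).castSucc ≠ Fin.last (m + 1) := (Fin.castSucc_lt_last _).ne
  refine Or.inl ⟨rfl, (Fin.last m).castSucc, Fin.castSucc_lt_last _, fun i hi => ?_, ?_,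
    fun j hj => ?_⟩
  · simp [innerVertex, hi.ne, (hi.trans (Fin.castSucc_lt_last _)).ne]
  · simpa [innerVertex, hl] using hab
  · have : j = Fin.last (m + 1) := by
      apply Fin.ext
      have h1 : m < j.val := hj
      have h2 := j.isLt
      simp only [Fin.val_last]
      omega
    subst this
    simp [innerVertex, hl]

theorem inTriangle_innerVertex (hk : 3 ≤ k) (a : Fin k) {b c : Fin k} (hbc : b ≠ c) (z : Fin k) :
    InTriangle (sierpinskiPP (m + 1 + 2) k) (innerVertex a b z) (innerVertex a c z) := by
  refine (inTriangle_iff hk).2 ⟨⟨rfl, fun i hi => ?_⟩, fun e => hbc ?_⟩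
  · simp [innerVertex, hi.ne]
  · have := congrFun (congrArg Prod.snd e) (Fin.last (m + 1))
    simpa [innerVertex] using this

/-- The last two letters run through `ab, ba, bc, cb, ca, ac`. -/
theorem hasAlternatingHexagon_innerVertex (hk : 3 ≤ k) {a b c : Fin k} (hab : a ≠ b) (hac : a ≠ c)
    (hbc : b ≠ c) (z : Fin k) :
    HasAlternatingHexagon (sierpinskiPP (m + 1 + 2) k) (innerVertex a b z) :=
  ⟨innerVertex b a z, innerVertex b c z, innerVertex c b z, innerVertex c a z, innerVertex a c z,
    (isLonelyEdge_iff hk).2 (isPartner_innerVertex hab z), inTriangle_innerVertex hk _ hac z,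
    (isLonelyEdge_iff hk).2 (isPartner_innerVertex hbc z), inTriangle_innerVertex hk _ hab.symm z,
    (isLonelyEdge_iff hk).2 (isPartner_innerVertex hac.symm z),
    inTriangle_innerVertex hk _ hbc.symm z⟩

/-- The first edge leaves the copy `i`, and the walk must return through the edge `y y'`. The edge
`x x'` stays inside the copy of `v'`, because `x` is not extreme. As two copies share one edge, `y =
v'`, and then `x` and `x'` lie in one clique, which is impossible. -/
theorem not_hasAlternatingHexagon_extremeVertex (hk : 3 ≤ k) (i : Fin (k + 1)) (a : Fin k) :
    ¬ HasAlternatingHexagon (sierpinskiPP (m + 1 + 2) k) (i, extremeVertex (m + 2) k a) := by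
  rintro ⟨v', x, x', y, y', h1, h2, h3, h4, h5, h6⟩
  rw [isLonelyEdge_iff hk] at h1 h3 h5
  rw [inTriangle_iff hk] at h2 h4 h6
  have h0 : (0 : Fin (m + 2)) < Fin.last (m + 1) := Fin.last_pos
  obtain ⟨a', b, -, hv', ha, hb⟩ : ∃ a' b, extremeVertex (m + 2) k a = (fun _ => a') ∧
      v'.2 = (fun _ => b) ∧ i.succAbove a' = v'.1 ∧ v'.1.succAbove b = i := by
    rcases h1 with ⟨-, t, ht, -, hne, hj⟩ | h
    · exact absurd (hj _ ht).1 hne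
    · exact h
  have hvi : v'.1 ≠ i := ha ▸ Fin.succAbove_ne _ _
  have hx : x.1 = x'.1 := by
    rcases h3 with h | ⟨d, e, hd, -⟩
    · exact h.1
    · refine absurd (Prod.ext h2.1.1 (funext fun t => ?_)) h2.2
      rw [hd, ← congrFun hd 0, ← h2.1.2 0 h0, hv']
  have hy1 : y.1 = v'.1 := by rw [← h4.1.1, ← hx, h2.1.1]
  have hy : y = v' := by
    rcases h5 with h | ⟨d, e, hd, -, hde, -⟩
    · exact absurd (hy1.symm.trans (h.1.trans h6.1.1)) hvi
    · refine Prod.ext hy1 ?_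
      rw [hd, hv']
      funext _
      apply v'.1.succAbove_right_injective
      rw [hb, ← hy1, hde, h6.1.1]
  subst hy
  exact h3.not_sameClique (h2.1.symm.trans h4.1.symm)

theorem not_isCayleyGraph_sierpinskiPP (hk : 3 ≤ k) :
    ¬ IsCayleyGraph (sierpinskiPP (m + 1 + 2) k) := by
  intro h
  let a : Fin k := ⟨0, by omega⟩
  let b : Fin k := ⟨1, by omega⟩
  let c : Fin k := ⟨2, by omega⟩
  obtain ⟨ψ, hψ⟩ := h.exists_iso_apply_eq (innerVertex a b a) (0, extremeVertex (m + 2) k a)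
  refine not_hasAlternatingHexagon_extremeVertex (m := m) hk 0 a ?_
  rw [← hψ]
  refine (hasAlternatingHexagon_innerVertex hk (c := c) ?_ ?_ ?_ a).map ψ <;>
  simp [a, b, c, Fin.ext_iff]

end NotTransitive

/-! ### If `S⁺⁺(2, k)` is a Cayley graph, then `k + 1` is a prime power -/

section PrimePower

variable {k : ℕ}

theorem isPrimePow_of_isCayleyGraph_sierpinskiPP_two (hk : 3 ≤ k)
    (h : IsCayleyGraph (sierpinskiPP 2 k)) : IsPrimePow (k + 1) := by
  obtain ⟨G, _, C, -, ⟨φ⟩⟩ := h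
  have hclique : ∀ p q : Fin (k + 1) × (Fin (0 + 1) → Fin k), SameClique p q ↔ p.1 = q.1 :=
    fun p q => ⟨fun h => h.1, fun h => ⟨h, fun i hi => absurd hi (Nat.not_lt_zero i.val)⟩⟩
  have htrans : ∀ u v g : G, (φ.symm u).1 = (φ.symm v).1 →
      (φ.symm (u * g)).1 = (φ.symm (v * g)).1 := by
    intro u v g h
    rw [← cayleyTranslation_apply φ, ← cayleyTranslation_apply φ]
    exact (hclique _ _).1 (sameClique_map hk (cayleyTranslation φ g) ((hclique _ _).2 h))
  -- The elements in the clique of `1`; closure holds because right multiplication permutes the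
  -- cliques.
  let H : Subgroup G :=
    { carrier := {h | (φ.symm 1).1 = (φ.symm h).1}
      one_mem' := rfl
      mul_mem' := by
        intro g h hg hh
        have := htrans 1 g h hg
        rw [one_mul] at this
        exact hh.trans this
      inv_mem' := by
        intro h hh
        have := htrans 1 h h⁻¹ hh
        rw [one_mul, mul_inv_cancel] at this
        exact this.symm }
  have hH : ∀ u v : G, (φ.symm u).1 = (φ.symm v).1 ↔ v * u⁻¹ ∈ H := by
    intro u v
    constructor
    · intro h
      have := htrans u v u⁻¹ h
      rwa [mul_inv_cancel] at this
    · intro h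
      have := htrans 1 (v * u⁻¹) u h
      rwa [one_mul, inv_mul_cancel_right] at this
  -- Fixing the copies of `u` and `v` fixes the end `p` of the unique edge between them, and right
  -- multiplication by `g ≠ 1` has no fixed vertex.
  have hfix : ∀ u v g : G, (φ.symm u).1 ≠ (φ.symm v).1 → (φ.symm u).1 = (φ.symm (u * g)).1 →
      (φ.symm v).1 = (φ.symm (v * g)).1 → g = 1 := by
    intro u v g huv hu hv
    obtain ⟨a, ha⟩ := Fin.exists_succAbove_eq huv.symm
    obtain ⟨b, hb⟩ := Fin.exists_succAbove_eq huv
    let p : Fin (k + 1) × (Fin (0 + 1) → Fin k) := ((φ.symm u).1, fun _ => a)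
    let q : Fin (k + 1) × (Fin (0 + 1) → Fin k) := ((φ.symm v).1, fun _ => b)
    let ψ := cayleyTranslation φ g
    have hpq : IsPartner p q := Or.inr ⟨a, b, rfl, rfl, ha, hb⟩
    have hpq' := isPartner_map hk ψ hpq
    have hp : (ψ p).1 = p.1 := by
      rw [← (hclique _ _).1 (sameClique_map hk ψ ((hclique (φ.symm u) p).2 rfl))]
      change (cayleyTranslation φ g (φ.symm u)).1 = _
      rw [cayleyTranslation_apply φ, ← hu]
    have hq : (ψ q).1 = q.1 := by
      rw [← (hclique _ _).1 (sameClique_map hk ψ ((hclique (φ.symm v) q).2 rfl))]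
      change (cayleyTranslation φ g (φ.symm v)).1 = _
      rw [cayleyTranslation_apply φ, ← hv]
    have hpp : ψ p = p := by
      rcases hpq' with h | ⟨c, d, hc, -, hcd, -⟩
      · exact absurd (hp.symm.trans (h.1.trans hq)) huv
      · refine Prod.ext hp ?_
        rw [hc]
        funext _
        apply p.1.succAbove_right_injective
        rw [← hp, hcd, hp, hq]
        exact ha.symm
    have := cayleyTranslation_apply φ g (φ p)
    rw [RelIso.symm_apply_apply] at this
    have h2 := φ.symm.injective ((φ.symm_apply_apply p).trans (hpp.symm.trans this))
    exact mul_eq_left.1 h2.symm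
  have hfin : Finite G := Finite.of_equiv _ φ.toEquiv
  have hG : Nat.card G = k * (k + 1) := by
    rw [← Nat.card_congr φ.toEquiv]
    simp [mul_comm]
  have hHcard : Nat.card H = k := by
    have e : H ≃ (Fin (2 - 1) → Fin k) :=
      { toFun := fun h => (φ.symm h).2
        invFun := fun x => ⟨φ ((φ.symm 1).1, x), by
          change _ = (φ.symm (φ _)).1
          rw [RelIso.symm_apply_apply]⟩
        left_inv := by
          rintro ⟨h, hh : (φ.symm 1).1 = (φ.symm h).1⟩
          apply Subtype.ext
          simp [hh]
        right_inv := fun x => by simp }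
    rw [Nat.card_congr e]
    simp
  refine isPrimePow_of_malnormal (by omega) hHcard hG fun g hg h hh hgh => ?_
  -- Right multiplication by `h` fixes the copy of `g⁻¹` exactly when `g⁻¹ * h * g ∈ H`.
  refine hfix 1 g⁻¹ h ?_ ?_ ?_
  · rw [Ne, hH]
    simpa using hg
  · rw [hH]
    simpa using hh
  · rw [hH]
    simpa using hgh

end PrimePower

/-! ### The cases `n = 1` and `k ≤ 2` -/

section Small

theorem isCayleyGraph_top (V : Type) [Finite V] [Nonempty V] :
    IsCayleyGraph (⊤ : SimpleGraph V) := by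
  have : NeZero (Nat.card V) := ⟨Nat.card_pos.ne'⟩
  have hC : IsConnectionSet ({1}ᶜ : Set (Multiplicative (ZMod (Nat.card V)))) :=
    ⟨fun h => h rfl, fun c hc h => hc (inv_eq_one.1 h)⟩
  let e : V ≃ Multiplicative (ZMod (Nat.card V)) :=
    (Finite.equivFin V).trans ((Finite.equivFinOfCardEq (Nat.card_zmod _)).symm.trans
      Multiplicative.ofAdd)
  refine ⟨_, inferInstance, _, hC, ⟨⟨e, ?_⟩⟩⟩
  intro u v
  rw [cayleyGraph_adj hC, SimpleGraph.top_adj, Set.mem_compl_singleton_iff, ne_eq, mul_inv_eq_one,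
    e.apply_eq_iff_eq, eq_comm]

theorem sierpinskiPP_one_right (n : ℕ) : sierpinskiPP n 1 = ⊤ := by
  ext p q
  rw [SimpleGraph.top_adj]
  refine ⟨fun h => h.ne, fun h => ?_⟩
  have h1 : p.1 ≠ q.1 := fun h1 => h (Prod.ext h1 (Subsingleton.elim _ _))
  obtain ⟨a, ha⟩ := Fin.exists_succAbove_eq h1.symm
  obtain ⟨b, hb⟩ := Fin.exists_succAbove_eq h1
  exact Or.inr ⟨a, b, Subsingleton.elim _ _, Subsingleton.elim _ _, ha, hb⟩

/-- The number with the binary expansion `w`, the first letter being the most significant one. -/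
def binaryValue : (n : ℕ) → (Fin n → Fin 2) → ℕ
  | 0, _ => 0
  | n + 1, w => (w 0).val * 2 ^ n + binaryValue n (Fin.tail w)

theorem binaryValue_lt : ∀ (n : ℕ) (w : Fin n → Fin 2), binaryValue n w < 2 ^ n
  | 0, _ => by simp [binaryValue]
  | n + 1, w => by
    have h1 := binaryValue_lt n (Fin.tail w)
    have h2 := (w 0).isLt
    rw [binaryValue, pow_succ]
    nlinarith

theorem binaryValue_injective : ∀ n : ℕ, Function.Injective (binaryValue n)
  | 0 => fun _ _ _ => Subsingleton.elim _ _
  | n + 1 => fun u v h => by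
    have hu := binaryValue_lt n (Fin.tail u)
    have hv := binaryValue_lt n (Fin.tail v)
    have h0 := (u 0).isLt
    have h0' := (v 0).isLt
    simp only [binaryValue] at h
    have h1 : (u 0).val = (v 0).val := by
      rcases lt_trichotomy (u 0).val (v 0).val with hlt | heq | hlt
      · nlinarith
      · exact heq
      · nlinarith
    rw [h1] at h
    have h2 := binaryValue_injective n (Nat.add_left_cancel h)
    rw [← Fin.cons_self_tail u, ← Fin.cons_self_tail v, Fin.ext h1, h2]

theorem binaryValue_zero (n : ℕ) : binaryValue n (extremeVertex n 2 0) = 0 := by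
  induction n with
  | zero => rfl
  | succ n ih =>
    change 0 * 2 ^ n + binaryValue n (extremeVertex n 2 0) = 0
    rw [ih, zero_mul]

theorem binaryValue_one (n : ℕ) : binaryValue n (extremeVertex n 2 1) + 1 = 2 ^ n := by
  induction n with
  | zero => rfl
  | succ n ih =>
    change 1 * 2 ^ n + binaryValue n (extremeVertex n 2 1) + 1 = 2 ^ (n + 1)
    rw [add_assoc, ih, pow_succ]
    ring

theorem binaryValue_eq_zero {n : ℕ} {w : Fin n → Fin 2} :
    binaryValue n w = 0 ↔ w = extremeVertex n 2 0 := by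
  rw [← (binaryValue_injective n).eq_iff, binaryValue_zero]

theorem binaryValue_add_one_eq {n : ℕ} {w : Fin n → Fin 2} :
    binaryValue n w + 1 = 2 ^ n ↔ w = extremeVertex n 2 1 := by
  rw [← (binaryValue_injective n).eq_iff, ← binaryValue_one n, Nat.add_right_cancel_iff]

theorem sierpinski_succ_adj {n k : ℕ} (u v : Fin (n + 1) → Fin k) :
    (sierpinski (n + 1) k).Adj u v ↔
      (u 0 = v 0 ∧ (sierpinski n k).Adj (Fin.tail u) (Fin.tail v)) ∨
      (u 0 ≠ v 0 ∧ Fin.tail u = extremeVertex n k (v 0) ∧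
        Fin.tail v = extremeVertex n k (u 0)) := by
  constructor
  · rintro ⟨t, h1, h2, h3⟩
    induction t using Fin.cases with
    | zero =>
      exact Or.inr ⟨h2, funext fun i => (h3 i.succ (Fin.succ_pos i)).1,
        funext fun i => (h3 i.succ (Fin.succ_pos i)).2⟩
    | succ t =>
      exact Or.inl ⟨h1 0 (Fin.succ_pos t), t, fun i hi => h1 i.succ (Fin.succ_lt_succ_iff.2 hi), h2,
        fun i hi => h3 i.succ (Fin.succ_lt_succ_iff.2 hi)⟩
  · rintro (⟨h, t, h1, h2, h3⟩ | ⟨h, h1, h2⟩)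
    · refine ⟨t.succ, fun i hi => ?_, h2, fun i hi => ?_⟩
      · induction i using Fin.cases with
        | zero => exact h
        | succ i => exact h1 i (Fin.succ_lt_succ_iff.1 hi)
      · induction i using Fin.cases with
        | zero => exact absurd hi (Fin.not_lt_zero _)
        | succ i => exact h3 i (Fin.succ_lt_succ_iff.1 hi)
    · refine ⟨0, fun i hi => absurd hi (Fin.not_lt_zero _), h, fun i hi => ?_⟩
      induction i using Fin.cases with
      | zero => exact absurd hi (lt_irrefl _)
      | succ i => exact ⟨congrFun h1 i, congrFun h2 i⟩

/-- Adjacent words have the form `w01⋯1` and `w10⋯0`: a binary increment with carry. So `S(n, 2)` is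
a path whose ends are the extreme vertices. -/
theorem sierpinski_two_adj : ∀ {n : ℕ} (u v : Fin n → Fin 2),
    (sierpinski n 2).Adj u v ↔
      binaryValue n v = binaryValue n u + 1 ∨ binaryValue n u = binaryValue n v + 1
  | 0, u, v => by
    simp only [binaryValue]
    exact ⟨fun ⟨t, _⟩ => t.elim0, by simp⟩
  | n + 1, u, v => by
    rw [sierpinski_succ_adj, sierpinski_two_adj]
    have hu := binaryValue_lt n (Fin.tail u)
    have hv := binaryValue_lt n (Fin.tail v)
    have hu0 := binaryValue_eq_zero (w := Fin.tail u)
    have hv0 := binaryValue_eq_zero (w := Fin.tail v)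
    have hu1 := binaryValue_add_one_eq (w := Fin.tail u)
    have hv1 := binaryValue_add_one_eq (w := Fin.tail v)
    simp only [binaryValue]
    generalize u 0 = a at *
    generalize v 0 = b at *
    fin_cases a <;> fin_cases b <;> simp [← hu0, ← hv0, ← hu1, ← hv1] <;> omega

/-- The position of a vertex of `S⁺⁺(n, 2)` on the cycle of length `3 * 2 ^ (n - 1)`: the copy `1`
comes first, it is followed by the copies `2` and `0` in reverse order. -/
def cyclePosition (n : ℕ) (p : Fin 3 × (Fin (n - 1) → Fin 2)) : ℕ :=
  ![3 * 2 ^ (n - 1) - 1 - binaryValue (n - 1) p.2, binaryValue (n - 1) p.2,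
    2 * 2 ^ (n - 1) - 1 - binaryValue (n - 1) p.2] p.1

theorem cyclePosition_lt (n : ℕ) (p : Fin 3 × (Fin (n - 1) → Fin 2)) :
    cyclePosition n p < 3 * 2 ^ (n - 1) := by
  obtain ⟨i, w⟩ := p
  have := binaryValue_lt _ w
  fin_cases i <;> simp [cyclePosition] <;> omega

theorem cyclePosition_injective (n : ℕ) : Function.Injective (cyclePosition n) := by
  rintro ⟨i, w⟩ ⟨j, x⟩ h
  have hw := binaryValue_lt _ w
  have hx := binaryValue_lt _ x
  have hwx := (binaryValue_injective _).eq_iff (a := w) (b := x)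
  fin_cases i <;> fin_cases j <;> simp [cyclePosition, ← hwx] at h ⊢ <;> omega

theorem sierpinskiPP_two_right_adj {n : ℕ} (p q : Fin 3 × (Fin (n - 1) → Fin 2)) :
    (sierpinskiPP n 2).Adj p q ↔
      (cyclePosition n q = cyclePosition n p + 1 ∨
        (cyclePosition n p + 1 = 3 * 2 ^ (n - 1) ∧ cyclePosition n q = 0)) ∨
      (cyclePosition n p = cyclePosition n q + 1 ∨
        (cyclePosition n q + 1 = 3 * 2 ^ (n - 1) ∧ cyclePosition n p = 0)) := by
  obtain ⟨i, w⟩ := p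
  obtain ⟨j, x⟩ := q
  have hw := binaryValue_lt _ w
  have hx := binaryValue_lt _ x
  have hw0 := binaryValue_eq_zero (w := w)
  have hx0 := binaryValue_eq_zero (w := x)
  have hw1 := binaryValue_add_one_eq (w := w)
  have hx1 := binaryValue_add_one_eq (w := x)
  -- The three edges between copies join the ends of three paths into a cycle: copy `1` upwards,
  -- then copies `2` and `0` downwards, and back.
  have hs : ∀ (i j : Fin 3) (c d : Fin 2), i.succAbove c = j ∧ j.succAbove d = i ↔
      (i = 0 ∧ j = 1 ∧ c = 0 ∧ d = 0) ∨ (i = 1 ∧ j = 0 ∧ c = 0 ∧ d = 0) ∨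
      (i = 0 ∧ j = 2 ∧ c = 1 ∧ d = 0) ∨ (i = 2 ∧ j = 0 ∧ c = 0 ∧ d = 1) ∨
      (i = 1 ∧ j = 2 ∧ c = 1 ∧ d = 1) ∨ (i = 2 ∧ j = 1 ∧ c = 1 ∧ d = 1) := by decide
  simp only [sierpinskiPP, sierpinski_two_adj, hs]
  fin_cases i <;> fin_cases j <;>
    simp [cyclePosition, ← hw0, ← hx0, ← hw1, ← hx1] <;> omega

theorem isCayleyGraph_sierpinskiPP_two_right (n : ℕ) : IsCayleyGraph (sierpinskiPP n 2) := by
  set N := 3 * 2 ^ (n - 1) with hN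
  have hN3 : 3 ≤ N := by
    have := Nat.one_le_two_pow (n := n - 1)
    omega
  have : NeZero N := ⟨by omega⟩
  have : Fact (1 < N) := ⟨by omega⟩
  let C : Set (Multiplicative (ZMod N)) := {Multiplicative.ofAdd 1, Multiplicative.ofAdd (-1)}
  have hC : IsConnectionSet C := by
    constructor
    · rintro (h | h)
      · exact one_ne_zero (Multiplicative.ofAdd.injective h).symm
      · exact neg_ne_zero.2 (one_ne_zero (α := ZMod N)) (Multiplicative.ofAdd.injective h).symm
    · rintro c (rfl | rfl)
      · exact Or.inr rfl
      · exact Or.inl (by rw [← ofAdd_neg, neg_neg])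
  let f : Fin 3 × (Fin (n - 1) → Fin 2) → Multiplicative (ZMod N) := fun p =>
    Multiplicative.ofAdd (cyclePosition n p : ZMod N)
  have hcast : ∀ a b : ℕ, a < N → b < N → ((b : ZMod N) = a + 1 ↔ b = a + 1 ∨ a + 1 = N ∧ b = 0) := by
    intro a b ha hb
    rw [← Nat.cast_one (R := ZMod N), ← Nat.cast_add, ZMod.natCast_eq_natCast_iff',
      Nat.mod_eq_of_lt hb]
    rcases Nat.lt_or_ge (a + 1) N with h | h
    · rw [Nat.mod_eq_of_lt h]
      omega
    · have : a + 1 = N := by omega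
      rw [this, Nat.mod_self]
      omega
  have hf : Function.Injective f := by
    intro p q h
    apply cyclePosition_injective n
    have h1 := Multiplicative.ofAdd.injective h
    rwa [ZMod.natCast_eq_natCast_iff', Nat.mod_eq_of_lt (cyclePosition_lt n p),
      Nat.mod_eq_of_lt (cyclePosition_lt n q)] at h1
  have hbij : Function.Bijective f := by
    refine (Nat.bijective_iff_injective_and_card f).2 ⟨hf, ?_⟩
    rw [Nat.card_congr Multiplicative.toAdd, Nat.card_zmod]
    simp [hN]
  refine ⟨_, inferInstance, C, hC, ⟨⟨Equiv.ofBijective f hbij, ?_⟩⟩⟩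
  intro p q
  rw [cayleyGraph_adj hC, sierpinskiPP_two_right_adj,
    ← hcast _ _ (cyclePosition_lt n p) (cyclePosition_lt n q),
    ← hcast _ _ (cyclePosition_lt n q) (cyclePosition_lt n p)]
  change Multiplicative.ofAdd _ = _ ∨ Multiplicative.ofAdd _ = _ ↔ _
  rw [Multiplicative.ofAdd.apply_eq_iff_eq, Multiplicative.ofAdd.apply_eq_iff_eq]
  change (cyclePosition n q : ZMod N) + -cyclePosition n p = 1 ∨
    (cyclePosition n q : ZMod N) + -cyclePosition n p = -1 ↔ _
  refine or_congr ⟨fun h => ?_, fun h => ?_⟩ ⟨fun h => ?_, fun h => ?_⟩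
  · rw [← h]; ring
  · rw [h]; ring
  · linear_combination -h
  · rw [h]; ring

end Small

/-! ### The group `AGL(1, F)` -/

section Affine

variable {F : Type*} [Field F]

theorem affineEquiv_apply (f : F ≃ᵃ[F] F) (x : F) : f x = (f 1 - f 0) * x + f 0 := by
  have h : ∀ y, f y = y * f.linear 1 + f 0 := by
    intro y
    have h1 := f.map_vadd 0 y
    rw [vadd_eq_add, vadd_eq_add, add_zero] at h1
    rw [h1]
    congr 1
    have := f.linear.map_smul y 1
    rwa [smul_eq_mul, mul_one, smul_eq_mul] at this
  rw [h x, h 1]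
  ring

theorem affineEquiv_ext {f g : F ≃ᵃ[F] F} (h0 : f 0 = g 0) (h1 : f 1 = g 1) : f = g := by
  ext x
  rw [affineEquiv_apply f, affineEquiv_apply g, h0, h1]

theorem affineEquiv_mul_apply (f g : F ≃ᵃ[F] F) (x : F) : (f * g) x = f (g x) := rfl

theorem affineEquiv_inv_apply_self (f : F ≃ᵃ[F] F) (x : F) : f⁻¹ (f x) = x := f.symm_apply_apply x

theorem affineEquiv_apply_inv_self (f : F ≃ᵃ[F] F) (x : F) : f (f⁻¹ x) = x := f.apply_symm_apply x

/-- The map `x ↦ a x + b`. -/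
def affineMk (a : Fˣ) (b : F) : F ≃ᵃ[F] F :=
  AffineEquiv.constVAdd F F b * (LinearEquiv.smulOfUnit a : F ≃ₗ[F] F).toAffineEquiv

theorem affineMk_apply (a : Fˣ) (b x : F) : affineMk a b x = a * x + b := by
  change b + a * x = _
  ring

/-- An element of `AGL(1, F)` is determined by its slope and its value at `0`. -/
def affineEquivEquiv : (F ≃ᵃ[F] F) ≃ Fˣ × F where
  toFun f := (Units.mk0 (f 1 - f 0) (sub_ne_zero.2 (f.injective.ne one_ne_zero)), f 0)
  invFun z := affineMk z.1 z.2
  left_inv f := by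
    apply affineEquiv_ext <;> simp [affineMk_apply]
  right_inv z := by
    ext <;> simp [affineMk_apply]

theorem card_affineEquiv (F : Type*) [Field F] :
    Nat.card (F ≃ᵃ[F] F) = (Nat.card F - 1) * Nat.card F := by
  rw [Nat.card_congr affineEquivEquiv, Nat.card_prod, Nat.card_units]

theorem mem_aglStabilizer {f : F ≃ᵃ[F] F} : f ∈ aglStabilizer F ↔ f 0 = 0 := Iff.rfl

theorem card_aglStabilizer (F : Type*) [Field F] : Nat.card (aglStabilizer F) = Nat.card F - 1 := by
  rw [← Nat.card_units]
  refine (Nat.card_congr (Equiv.ofBijective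
    (fun a : Fˣ => (⟨affineMk a 0, ?_⟩ : aglStabilizer F)) ⟨?_, ?_⟩)).symm
  · simp [mem_aglStabilizer, affineMk_apply]
  · intro a b h
    have := congrArg (fun f : aglStabilizer F => (f : F ≃ᵃ[F] F) 1) h
    simpa [affineMk_apply, Units.ext_iff] using this
  · rintro ⟨f, hf⟩
    have hf0 : f 0 = 0 := hf
    have hf1 : f 1 ≠ 0 := fun h => one_ne_zero (f.injective (h.trans hf0.symm))
    refine ⟨Units.mk0 _ hf1, Subtype.ext (affineEquiv_ext ?_ ?_)⟩
    · simp [affineMk_apply, hf0]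
    · simp [affineMk_apply]

theorem mem_aglTranslations {f : F ≃ᵃ[F] F} : f ∈ aglTranslations F ↔ ∀ x, f x = x + f 0 := by
  constructor
  · rintro ⟨b, rfl⟩ x
    change b.toAdd + x = x + (b.toAdd + 0)
    ring
  · intro h
    refine ⟨Multiplicative.ofAdd (f 0), AffineEquiv.ext fun x => ?_⟩
    rw [h x]
    change f 0 + x = x + f 0
    ring

theorem affineMk_one_mem (b : F) : affineMk 1 b ∈ aglTranslations F := by
  rw [mem_aglTranslations]
  simp [affineMk_apply]

theorem eq_affineMk_one {f : F ≃ᵃ[F] F} (h : f ∈ aglTranslations F) : f = affineMk 1 (f 0) := by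
  rw [mem_aglTranslations] at h
  ext x
  rw [h, affineMk_apply]
  simp

theorem card_aglTranslations (F : Type*) [Field F] : Nat.card (aglTranslations F) = Nat.card F := by
  refine (Nat.card_congr (Equiv.ofBijective
    (fun b : F => (⟨affineMk 1 b, affineMk_one_mem b⟩ : aglTranslations F)) ⟨?_, ?_⟩)).symm
  · intro a b h
    have := congrArg (fun f : aglTranslations F => (f : F ≃ᵃ[F] F) 0) h
    simpa [affineMk_apply] using this
  · rintro ⟨f, hf⟩
    exact ⟨f 0, Subtype.ext (eq_affineMk_one hf).symm⟩

/-- The map `h` fixes both `0` and `g 0 ≠ 0`, and an affine map of the line with two fixed points is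
the identity. -/
theorem aglStabilizer_malnormal {g h : F ≃ᵃ[F] F} (hg : g ∉ aglStabilizer F)
    (hh : h ∈ aglStabilizer F) (hgh : g⁻¹ * h * g ∈ aglStabilizer F) : h = 1 := by
  have h0 : h 0 = 0 := hh
  have h1 : g⁻¹ (h (g 0)) = 0 := hgh
  have h2 : h (g 0) = g 0 := by rw [← affineEquiv_apply_inv_self g (h (g 0)), h1]
  apply affineEquiv_ext
  · exact h0
  · rw [affineEquiv_apply, h0, sub_zero, add_zero] at h2
    exact mul_eq_right₀ hg |>.1 h2

theorem isFrobeniusComplement_aglStabilizer (hF : 2 < Nat.card F) :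
    IsFrobeniusComplement (aglStabilizer F) := by
  refine ⟨?_, ?_, ?_⟩
  · intro h
    have := card_aglStabilizer F
    rw [h, Subgroup.card_bot] at this
    omega
  · intro h
    have h1 : affineMk 1 (1 : F) ∈ aglStabilizer F := h ▸ Subgroup.mem_top _
    rw [mem_aglStabilizer, affineMk_apply] at h1
    simp at h1
  · intro g hg
    refine Set.eq_singleton_iff_unique_mem.2 ⟨⟨one_mem _, 1, one_mem _, by simp⟩, ?_⟩
    rintro x ⟨hx, h, hh, rfl⟩
    rw [aglStabilizer_malnormal hg hh hx]
    simp

/-- A translation with a fixed point is trivial. A map of slope `a ≠ 1` and value `b` at `0` fixes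
`b / (1 - a)`, and moving this point to `0` conjugates it into the stabilizer. -/
theorem isFrobeniusKernel_aglTranslations (F : Type*) [Field F] :
    IsFrobeniusKernel (aglStabilizer F) (aglTranslations F) := by
  ext f
  rw [SetLike.mem_coe, mem_aglTranslations]
  simp only [Set.mem_sdiff, Set.mem_univ, true_and, Set.mem_iUnion, Set.mem_ofPred_eq, not_exists,
    not_and]
  constructor
  · rintro hf g h (h0 : h 0 = 0) h1 rfl
    have h2 : (g⁻¹ * h * g) (g⁻¹ 0) = g⁻¹ 0 := by
      simp only [affineEquiv_mul_apply, affineEquiv_apply_inv_self, h0]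
    rw [hf, add_eq_left] at h2
    have h3 : g⁻¹ * h * g = 1 := AffineEquiv.ext fun x => by rw [hf, h2, add_zero]; rfl
    refine h1 ?_
    have : h = g * (g⁻¹ * h * g) * g⁻¹ := by group
    rw [this, h3]
    simp
  · intro hf
    by_contra hn
    have ha : f 1 - f 0 ≠ 1 := fun h => hn fun x => by rw [affineEquiv_apply, h, one_mul]
    have ha' : 1 - (f 1 - f 0) ≠ 0 := sub_ne_zero.2 ha.symm
    obtain ⟨x, hx⟩ : ∃ x, f x = x := by
      refine ⟨f 0 / (1 - (f 1 - f 0)), ?_⟩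
      rw [affineEquiv_apply]
      field_simp
      ring
    let g : F ≃ᵃ[F] F := affineMk 1 (-x)
    have hg : g x = 0 := by simp [g, affineMk_apply]
    have hg' : g⁻¹ 0 = x := by rw [← hg, affineEquiv_inv_apply_self]
    refine hf g (g * f * g⁻¹) ?_ ?_ (by group)
    · change g (f (g⁻¹ 0)) = 0
      rw [hg', hx, hg]
    · intro h
      have : f = 1 := by simpa using h
      exact hn fun y => by rw [this]; simp [AffineEquiv.one_def]

theorem isElementaryAbelianSubgroup_aglTranslations {p m : ℕ} (hF : Nat.card F = p ^ m) :
    IsElementaryAbelianSubgroup p (aglTranslations F) := by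
  -- The additive order of `1` divides `p ^ m`, and a field has no nilpotents.
  have hp : (p : F) = 0 := by
    have h : Nat.card F • (1 : F) = 0 := card_nsmul_eq_zero'
    rw [hF, nsmul_eq_mul, mul_one, Nat.cast_pow] at h
    exact eq_zero_of_pow_eq_zero h
  constructor
  · intro f hf g hg
    rw [mem_aglTranslations] at hf hg
    ext x
    simp only [affineEquiv_mul_apply]
    rw [hf (g x), hg x, hg (f x), hf x]
    ring
  · intro f hf
    rw [mem_aglTranslations] at hf
    have : ∀ j : ℕ, ∀ x, (f ^ j) x = x + j * f 0 := by
      intro j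
      induction j with
      | zero => intro x; simp [AffineEquiv.one_def]
      | succ j ih =>
        intro x
        rw [pow_succ, affineEquiv_mul_apply, ih, hf]
        push_cast
        ring
    ext x
    rw [this, hp]
    simp [AffineEquiv.one_def]

/-- Conjugation by scalings is transitive on the nontrivial translations, so a normal subgroup
containing one of them contains all. -/
theorem isMinimalNormal_aglTranslations (F : Type*) [Field F] :
    IsMinimalNormal (aglTranslations F) := by
  refine ⟨⟨⟨fun f hf g => ?_⟩, fun h => ?_⟩, ?_⟩
  · rw [mem_aglTranslations] at hf ⊢
    intro x
    simp only [affineEquiv_mul_apply]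
    rw [affineEquiv_apply g, affineEquiv_apply g (f (g⁻¹ 0)), hf, hf (g⁻¹ 0)]
    have h1 := affineEquiv_apply_inv_self g x
    have h2 := affineEquiv_apply_inv_self g 0
    rw [affineEquiv_apply g] at h1 h2
    linear_combination h1 - h2
  · have h1 := affineMk_one_mem (1 : F)
    rw [h, Subgroup.mem_bot] at h1
    have := congrArg (fun f : F ≃ᵃ[F] F => f 0) h1
    simp [affineMk_apply, AffineEquiv.one_def] at this
  · rintro K ⟨hK, hK1⟩ hle f hf
    obtain ⟨t, ht, ht1⟩ := K.ne_bot_iff_exists_ne_one.1 hK1 |>.elim fun t ht =>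
      (⟨t.1, t.2, fun e => ht (Subtype.ext e)⟩ : ∃ t : F ≃ᵃ[F] F, t ∈ K ∧ t ≠ 1)
    have htt := mem_aglTranslations.1 (hle ht)
    have hff := mem_aglTranslations.1 hf
    have ht0 : t 0 ≠ 0 := fun h => ht1 (AffineEquiv.ext fun x => by
      rw [htt, h, add_zero]; rfl)
    by_cases hf0 : f 0 = 0
    · have : f = 1 := AffineEquiv.ext fun x => by rw [hff, hf0, add_zero]; rfl
      exact this ▸ K.one_mem
    · let g : F ≃ᵃ[F] F := affineMk (Units.mk0 _ (div_ne_zero hf0 ht0)) 0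
      have hg : ∀ y, g y = f 0 / t 0 * y := fun y => by simp [g, affineMk_apply]
      have : f = g * t * g⁻¹ := by
        ext x
        have h1 := affineEquiv_apply_inv_self g x
        rw [hg] at h1
        rw [hff, affineEquiv_mul_apply, affineEquiv_mul_apply, hg, htt (g⁻¹ x), mul_add, h1,
          div_mul_cancel₀ _ ht0]
      rw [this]
      exact hK.conj_mem t ht g

theorem aglInvolution_mul_self (F : Type*) [Field F] : aglInvolution F * aglInvolution F = 1 := by
  ext x
  rw [affineEquiv_mul_apply, aglInvolution_apply, aglInvolution_apply]
  simp [AffineEquiv.one_def]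

theorem aglInvolution_notMem (F : Type*) [Field F] : aglInvolution F ∉ aglStabilizer F := by
  rw [mem_aglStabilizer, aglInvolution_apply]
  simp

theorem orderOf_aglInvolution (F : Type*) [Field F] : orderOf (aglInvolution F) = 2 := by
  refine orderOf_eq_prime (by rw [pow_two, aglInvolution_mul_self]) fun h => ?_
  exact aglInvolution_notMem F (h ▸ one_mem _)

theorem nonempty_iso_cayleyGraph_agl {k : ℕ} (hk : 1 ≤ k) (hF : Nat.card F = k + 1)
    [Finite (F ≃ᵃ[F] F)] :
    Nonempty (sierpinskiPP 2 k ≃g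
      cayleyGraph (complementConnectionSet (aglStabilizer F) (aglInvolution F))) := by
  refine nonempty_iso_cayleyGraph_complementConnectionSet hk ?_ ?_ (aglInvolution_mul_self F)
    (aglInvolution_notMem F) fun h hh hc => aglStabilizer_malnormal (aglInvolution_notMem F) hh hc
  · rw [card_aglStabilizer, hF, Nat.add_sub_cancel]
  · rw [card_affineEquiv, hF, Nat.add_sub_cancel]

end Affine

theorem isCayleyGraph_sierpinskiPP_two {k : ℕ} (hk : 1 ≤ k) (h : IsPrimePow (k + 1)) :
    IsCayleyGraph (sierpinskiPP 2 k) := by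
  obtain ⟨p, m, hp, hm, hpm⟩ := (isPrimePow_nat_iff _).1 h
  have : Fact p.Prime := ⟨hp⟩
  have hF : Nat.card (GaloisField p m) = k + 1 := by rw [GaloisField.card p m hm.ne', hpm]
  have : Finite (GaloisField p m) := Nat.finite_of_card_ne_zero (by omega)
  have : Finite (GaloisField p m ≃ᵃ[GaloisField p m] GaloisField p m) :=
    Finite.of_equiv _ affineEquivEquiv.symm
  exact ⟨_, inferInstance, _, isConnectionSet_complementConnectionSet (aglInvolution_mul_self _)
    (aglInvolution_notMem _), nonempty_iso_cayleyGraph_agl hk hF⟩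

theorem mainTheorem8 :
    -- the classification
    (∀ n k : ℕ, 1 ≤ n → 1 ≤ k →
      (IsCayleyGraph (sierpinskiPP n k) ↔ n = 1 ∨ k ≤ 2 ∨ (n = 2 ∧ IsPrimePow (k + 1)))) ∧
    -- the last case: every Frobenius group of the right shape gives a presentation
    (∀ k p m : ℕ, p.Prime → 1 ≤ m → k + 1 = p ^ m →
      ∀ (G : Type*) [Group G] [Finite G] (H N : Subgroup G) (c : G),
        IsFrobeniusComplement H → Nat.card H = p ^ m - 1 →
        IsFrobeniusKernel H N → IsElementaryAbelianSubgroup p N → IsMinimalNormal N →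
        Nat.card N = p ^ m → orderOf c = 2 → c ∉ H →
        IsConnectionSet (complementConnectionSet H c) ∧
        Nonempty (sierpinskiPP 2 k ≃g cayleyGraph (complementConnectionSet H c))) ∧
    -- the example AGL(1, q), which is a Frobenius group as soon as q > 2
    (∀ k p m : ℕ, p.Prime → 1 ≤ m → k + 1 = p ^ m →
      ∀ (F : Type*) [Field F], Nat.card F = p ^ m →
        Finite (F ≃ᵃ[F] F) ∧
        (2 < p ^ m → IsFrobeniusComplement (aglStabilizer F)) ∧
        Nat.card (aglStabilizer F) = p ^ m - 1 ∧
        IsFrobeniusKernel (aglStabilizer F) (aglTranslations F) ∧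
        IsElementaryAbelianSubgroup p (aglTranslations F) ∧
        IsMinimalNormal (aglTranslations F) ∧
        Nat.card (aglTranslations F) = p ^ m ∧
        orderOf (aglInvolution F) = 2 ∧ aglInvolution F ∉ aglStabilizer F ∧
        IsConnectionSet (complementConnectionSet (aglStabilizer F) (aglInvolution F)) ∧
        Nonempty (sierpinskiPP 2 k ≃g
          cayleyGraph (complementConnectionSet (aglStabilizer F) (aglInvolution F)))) := by
  refine ⟨fun n k hn hk => ⟨fun h => ?_, ?_⟩, ?_, ?_⟩
  · by_contra! hcon
    obtain ⟨h1, h2, h3⟩ := hcon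
    rcases (show n = 2 ∨ 3 ≤ n by omega) with rfl | hn3
    · exact h3 rfl (isPrimePow_of_isCayleyGraph_sierpinskiPP_two h2 h)
    · obtain ⟨m, rfl⟩ : ∃ m, n = m + 1 + 2 := ⟨n - 3, by omega⟩
      exact not_isCayleyGraph_sierpinskiPP h2 h
  · rintro (rfl | h | ⟨rfl, h⟩)
    · rw [sierpinskiPP_one]
      have : Nonempty (Fin k) := ⟨⟨0, hk⟩⟩
      exact isCayleyGraph_top _
    · rcases (show k = 1 ∨ k = 2 by omega) with rfl | rfl
      · rw [sierpinskiPP_one_right]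
        exact isCayleyGraph_top _
      · exact isCayleyGraph_sierpinskiPP_two_right n
    · exact isCayleyGraph_sierpinskiPP_two hk h
  · intro k p m hp hm hkp G _ _ H N c hH hHcard hN _ _ hNcard hc hcH
    have hc2 : c * c = 1 := by rw [← pow_two, ← hc, pow_orderOf_eq_one]
    have hk : 1 ≤ k := by
      have := Nat.one_lt_pow (Nat.one_le_iff_ne_zero.1 hm) hp.one_lt
      omega
    rw [← hkp, Nat.add_sub_cancel] at hHcard
    refine ⟨isConnectionSet_complementConnectionSet hc2 hcH,
      nonempty_iso_cayleyGraph_complementConnectionSet hk hHcard ?_ hc2 hcH (hH.malnormal c hcH)⟩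
    -- The order of the kernel enters only to give `Nat.card G = k * (k + 1)`.
    rw [card_of_isFrobeniusKernel hH hN, hHcard, hNcard, hkp]
  · intro k p m hp hm hkp F _ hF
    have hk : 1 ≤ k := by
      have := Nat.one_lt_pow (Nat.one_le_iff_ne_zero.1 hm) hp.one_lt
      omega
    have : Finite F := Nat.finite_of_card_ne_zero (by omega)
    have hfin : Finite (F ≃ᵃ[F] F) := Finite.of_equiv _ affineEquivEquiv.symm
    exact ⟨hfin, fun h => isFrobeniusComplement_aglStabilizer (hF ▸ h),
      by rw [card_aglStabilizer, hF], isFrobeniusKernel_aglTranslations F,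
      isElementaryAbelianSubgroup_aglTranslations hF, isMinimalNormal_aglTranslations F,
      by rw [card_aglTranslations, hF], orderOf_aglInvolution F, aglInvolution_notMem F,
      isConnectionSet_complementConnectionSet (aglInvolution_mul_self F) (aglInvolution_notMem F),
      nonempty_iso_cayleyGraph_agl hk (hF.trans hkp.symm)⟩
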